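/- Let $p$ be a prime number, let $\mathbb F$ be an algebraic closure of $\mathbb F_p$, let $H=\mathbb F((t^{\mathbb Q}))$ be the Hahn field of generalized power series with well-ordered support in $\mathbb Q$ and coefficients in $\mathbb F$, and let $K=\bigcup_{N\ge 1}\mathbb F((t^{1/N}))\subset H$ be the Newton–Puiseux field. Let $v\colon H\to\mathbb Q\cup\{\infty\}$ be the valuation $v(h)=\min(\operatorname{supp}(h))$, $v(0)=\infty$, and let $\overline K\subset H$ be the algebraic closure of $K$ in $H$. For $b\in\overline K$ let $\deg_K b$ be the degree of its minimal polynomial over $K$. For $(a,\delta)\in\overline K\times\mathbb Q$ put $$B_\delta(a)=\{b\in\overline K\mid v(b-a)\ge\delta\},\qquad \deg_K B_\delta(a)=\min\{\deg_K b\mid b\in B_\delta(a)\},$$ and call $(a,\delta)$ a minimal pair if $\deg_K B_\delta(a)=\deg_K a$. Define $$s_n=\sum_{j\ge n}\binom jn t^{-1/p^{j+1}}\quad(n\ge 0),\qquad s=\sum_{n\ge0}t^ns_n\in H,$$ $$S=\Big\{(n,i)\in\mathbb Z^2\ \Big|\ 0\le n\le i,\ p\nmid\binom in\Big\},\qquad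 \delta(n,i)=n-\frac1{p^{i+1}},$$ and for $(n,i)\in S$ let $s_{n,i}$ be the truncation of $s$ that consists of all its terms with exponent $<\delta(n,i)$; that is, $$s_{n,i}=\sum_{m=0}^{n-1}t^ms_m+t^n\sum_{j=n}^{i-1}\binom jn t^{-1/p^{j+1}}.$$ Then, for every $(n,i)\in S$, the element $s_{n,i}$ is algebraic over $K$, and the pair $(s_{n,i},\delta(n,i))$ is a minimal pair; more precisely, $$\deg_K B_{\delta(n,i)}(s_{n,i})=\deg_K s_{n,i}=p^n.$$ -/

import Mathlib

noncomputable section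

namespace MinPair

/-- The Hahn field `H = F((t^ℚ))` of generalized power series with well-ordered support in `ℚ`. -/
abbrev Hahn (F : Type*) [Field F] : Type _ := HahnSeries ℚ F

/-- The embedding `F((t)) → F((t^ℚ))` which sends `∑ a_k t^k` to `∑ a_k t^(k/N)`, for `N ≥ 1`.
Its range is the field `F((t^(1/N)))`. -/
def ramify (F : Type*) [Field F] (N : ℕ+) : LaurentSeries F →+* Hahn F :=
  HahnSeries.embDomainRingHom
    ((AddMonoidHom.mulRight ((N : ℚ)⁻¹)).comp (Int.castAddHom ℚ))
    (fun a b h => by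
      have hN : ((N : ℚ)⁻¹) ≠ 0 := inv_ne_zero (by exact_mod_cast N.pos.ne')
      simpa [hN] using h)
    (fun a b => by
      have hN : (0 : ℚ) < (N : ℚ)⁻¹ := inv_pos.mpr (by exact_mod_cast N.pos)
      simp)

/-- `F((t^(1/N)))` consists of the generalized power series with support in `(1/N)ℤ`. -/
theorem mem_range_ramify {F : Type*} [Field F] (N : ℕ+) (s : Hahn F) :
    s ∈ (ramify F N).fieldRange ↔ ∀ q ∈ s.support, ∃ k : ℤ, q = k * (N : ℚ)⁻¹ := by
  have hN : (0 : ℚ) < (N : ℚ)⁻¹ := inv_pos.mpr (by exact_mod_cast N.pos)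
  constructor
  · rintro ⟨y, rfl⟩ q hq
    obtain ⟨k, -, hk⟩ := HahnSeries.support_embDomain_subset hq
    exact ⟨k, hk.symm⟩
  · intro h
    have hmono : ∀ a b : ℤ, (a : ℚ) * (N : ℚ)⁻¹ ≤ b * (N : ℚ)⁻¹ → a ≤ b := fun a b hab => by
      exact_mod_cast le_of_mul_le_mul_right hab hN
    let y : LaurentSeries F :=
      { coeff := fun k => s.coeff (k * (N : ℚ)⁻¹)
        isPWO_support' := by
          rw [Set.isPWO_iff_exists_monotone_subseq]
          intro f hf
          obtain ⟨g, hg⟩ := s.isPWO_support.exists_monotone_subseq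
            (f := fun n => (f n : ℚ) * (N : ℚ)⁻¹) (fun n => hf n)
          exact ⟨g, fun a b hab => hmono _ _ (hg hab)⟩ }
    refine ⟨y, ?_⟩
    ext q
    by_cases hq : ∃ k : ℤ, q = k * (N : ℚ)⁻¹
    · obtain ⟨k, rfl⟩ := hq
      exact HahnSeries.embDomain_coeff (x := y) (a := k)
    · have h0 : s.coeff q = 0 := by
        by_contra hne
        exact hq (h q hne)
      rw [h0]
      refine HahnSeries.embDomain_of_notMem_range ?_
      rintro ⟨k, hk⟩
      exact hq ⟨k, hk.symm⟩

theorem range_ramify_le {F : Type*} [Field F] {N M : ℕ+} (h : (N : ℕ) ∣ M) :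
    (ramify F N).fieldRange ≤ (ramify F M).fieldRange := by
  intro s hs
  rw [mem_range_ramify] at hs ⊢
  intro q hq
  obtain ⟨k, rfl⟩ := hs q hq
  obtain ⟨c, hc⟩ := h
  have hM : ((M : ℕ) : ℚ) ≠ 0 := by exact_mod_cast M.pos.ne'
  have hN : ((N : ℕ) : ℚ) ≠ 0 := by exact_mod_cast N.pos.ne'
  have hc' : ((M : ℕ) : ℚ) = (N : ℕ) * c := by exact_mod_cast hc
  refine ⟨k * c, ?_⟩
  have hc0 : (c : ℚ) ≠ 0 := fun h0 => hM (by rw [hc', h0, mul_zero])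
  push_cast
  rw [hc']
  field_simp

theorem exists_common {F : Type*} [Field F] {a b : Hahn F}
    (ha : ∃ N : ℕ+, a ∈ (ramify F N).fieldRange) (hb : ∃ N : ℕ+, b ∈ (ramify F N).fieldRange) :
    ∃ N : ℕ+, a ∈ (ramify F N).fieldRange ∧ b ∈ (ramify F N).fieldRange := by
  obtain ⟨N, hN⟩ := ha
  obtain ⟨M, hM⟩ := hb
  exact ⟨N * M, range_ramify_le (by simp) hN, range_ramify_le (by simp) hM⟩

/-- The Newton–Puiseux field `K = ⋃_{N ≥ 1} F((t^(1/N)))`, as a subfield of `H = F((t^ℚ))`. -/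
def puiseux (F : Type*) [Field F] : Subfield (Hahn F) where
  carrier := {s | ∃ N : ℕ+, s ∈ (ramify F N).fieldRange}
  mul_mem' ha hb := by
    obtain ⟨N, h1, h2⟩ := exists_common ha hb
    exact ⟨N, mul_mem h1 h2⟩
  one_mem' := ⟨1, one_mem _⟩
  add_mem' ha hb := by
    obtain ⟨N, h1, h2⟩ := exists_common ha hb
    exact ⟨N, add_mem h1 h2⟩
  zero_mem' := ⟨1, zero_mem _⟩
  neg_mem' ha := by
    obtain ⟨N, h⟩ := ha
    exact ⟨N, neg_mem h⟩
  inv_mem' _ ha := by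
    obtain ⟨N, h⟩ := ha
    exact ⟨N, inv_mem h⟩

/-- The valuation `v : H → ℚ ∪ {∞}`, `v(s) = min (supp s)`, `v(0) = ∞`. -/
abbrev v (F : Type*) [Field F] : AddValuation (Hahn F) (WithTop ℚ) := HahnSeries.addVal ℚ F

/-- `K̄`: the algebraic closure of `K` inside `H`, i.e. the elements of `H` algebraic over `K`. -/
abbrev Kbar (F : Type*) [Field F] : IntermediateField (puiseux F) (Hahn F) :=
  algebraicClosure (puiseux F) (Hahn F)

/-- `deg_K a`, the degree of the minimal polynomial of `a ∈ K̄` over `K`. -/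
def degK {F : Type*} [Field F] (a : Kbar F) : ℕ := (minpoly (puiseux F) a).natDegree

/-- The ultrametric ball `B_δ(a) = {b ∈ K̄ | v(b - a) ≥ δ}`. -/
def ball {F : Type*} [Field F] (δ : ℚ) (a : Kbar F) : Set (Kbar F) :=
  {b | (δ : WithTop ℚ) ≤ v F ((b : Hahn F) - (a : Hahn F))}

/-- `deg_K B = min {deg_K b | b ∈ B}` (used for balls, which are never empty). -/
def ballDegK {F : Type*} [Field F] (B : Set (Kbar F)) : ℕ := sInf (degK '' B)

/-- `(a, δ) ∈ K̄ × ℚ` is a minimal pair if `deg_K B_δ(a) = deg_K a`. -/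
def IsMinimalPair {F : Type*} [Field F] (a : Kbar F) (δ : ℚ) : Prop :=
  ballDegK (ball δ a) = degK a

/-- `δ(n, i) = n - 1 / p^(i+1)`. -/
def delta (p : ℕ) (n i : ℕ) : ℚ := n - 1 / (p : ℚ) ^ (i + 1)

/-- `S`, the pairs `(n, i)` of integers with `0 ≤ n ≤ i` and `p ∤ binom(i, n)`. -/
def S (p : ℕ) : Set (ℕ × ℕ) := {x | x.1 ≤ x.2 ∧ ¬ p ∣ x.2.choose x.1}

theorem delta_strictMono (p : ℕ) [hp : Fact p.Prime] (n : ℕ) : StrictMono (delta p n) := by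
  have hp1 : (1 : ℚ) < p := by exact_mod_cast hp.out.one_lt
  intro i j hij
  have h1 : (p : ℚ) ^ (i + 1) < (p : ℚ) ^ (j + 1) := pow_lt_pow_right₀ hp1 (by omega)
  have h2 : 1 / (p : ℚ) ^ (j + 1) < 1 / (p : ℚ) ^ (i + 1) :=
    one_div_lt_one_div_of_lt (by positivity) h1
  simp only [delta]
  linarith

theorem delta_bounds (p : ℕ) [hp : Fact p.Prime] (n i : ℕ) :
    (n : ℚ) - 1 < delta p n i ∧ delta p n i < n := by
  have hp1 : (1 : ℚ) < p := by exact_mod_cast hp.out.one_lt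
  have h1 : 1 < (p : ℚ) ^ (i + 1) := one_lt_pow₀ hp1 (by omega)
  have h2 : 1 / (p : ℚ) ^ (i + 1) < 1 := by
    rw [div_lt_one (by positivity)]
    exact h1
  have h3 : 0 < 1 / (p : ℚ) ^ (i + 1) := by positivity
  simp only [delta]
  constructor <;> linarith

theorem delta_eq_imp (p : ℕ) [Fact p.Prime] {n i m j : ℕ} (h : delta p n i = delta p m j) :
    n = m ∧ i = j := by
  have h1 := delta_bounds p n i
  have h2 := delta_bounds p m j
  have hnm : n = m := by
    have a1 : (n : ℚ) < m + 1 := by linarith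
    have a2 : (m : ℚ) < n + 1 := by linarith
    have b1 : n < m + 1 := by exact_mod_cast a1
    have b2 : m < n + 1 := by exact_mod_cast a2
    omega
  subst hnm
  exact ⟨rfl, (delta_strictMono p n).injective h⟩

theorem isPWO_range_delta (p : ℕ) [Fact p.Prime] :
    (Set.range fun x : ℕ × ℕ => delta p x.1 x.2).IsPWO := by
  have hmono : Monotone fun x : ℕ ×ₗ ℕ => delta p (ofLex x).1 (ofLex x).2 := by
    intro x y hxy
    rcases (Prod.Lex.le_iff (x := x) (y := y)).mp hxy with h | ⟨h1, h2⟩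
    · have a1 := (delta_bounds p (ofLex x).1 (ofLex x).2).2
      have a2 := (delta_bounds p (ofLex y).1 (ofLex y).2).1
      have a3 : ((ofLex x).1 : ℚ) + 1 ≤ (ofLex y).1 := by exact_mod_cast h
      show delta p _ _ ≤ delta p _ _
      linarith
    · show delta p _ _ ≤ delta p _ _
      rw [h1]
      exact (delta_strictMono p _).monotone h2
  have := (Set.isPWO_of_wellQuasiOrderedLE (Set.univ : Set (ℕ ×ₗ ℕ))).image_of_monotone hmono
  refine this.mono ?_
  rintro _ ⟨x, rfl⟩
  exact ⟨toLex x, trivial, rfl⟩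

/-- The summable family of monomials `j ↦ binom(j, n) t^(-1/p^(j+1))`.
The terms with `j < n` vanish, because then `binom(j, n) = 0`. -/
def layerFamily (p : ℕ) [Fact p.Prime] (F : Type*) [Field F] (n : ℕ) :
    HahnSeries.SummableFamily ℚ F ℕ where
  toFun j := HahnSeries.single (-1 / (p : ℚ) ^ (j + 1)) ((j.choose n : ℕ) : F)
  isPWO_iUnion_support' := by
    refine (isPWO_range_delta p).mono ?_
    refine Set.iUnion_subset fun j => HahnSeries.support_single_subset.trans ?_
    rintro _ rfl
    refine ⟨(0, j), ?_⟩
    simp only [delta, Nat.cast_zero]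
    ring
  finite_co_support' q := by
    refine Set.Subsingleton.finite fun i hi j hj => ?_
    have key : ∀ k : ℕ, (HahnSeries.single (-1 / (p : ℚ) ^ (k + 1))
        ((k.choose n : ℕ) : F)).coeff q ≠ 0 → q = delta p 0 k := fun k hk => by
      have : q = -1 / (p : ℚ) ^ (k + 1) := HahnSeries.support_single_subset hk
      rw [this]
      simp only [delta, Nat.cast_zero]
      ring
    exact (delta_eq_imp p ((key i hi).symm.trans (key j hj))).2

/-- `s_n = ∑_{j ≥ n} binom(j, n) t^(-1/p^(j+1))`. -/
def layer (p : ℕ) [Fact p.Prime] (F : Type*) [Field F] (n : ℕ) : Hahn F :=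
  (layerFamily p F n).hsum

theorem support_shift_layer (p : ℕ) [Fact p.Prime] (F : Type*) [Field F] (n : ℕ) {q : ℚ}
    (hq : (HahnSeries.single (n : ℚ) (1 : F) * layer p F n).coeff q ≠ 0) :
    ∃ j, q = delta p n j := by
  rw [HahnSeries.coeff_single_mul, one_mul, layer, HahnSeries.SummableFamily.coeff_hsum] at hq
  obtain ⟨j, hj⟩ : ∃ j, (layerFamily p F n j).coeff (q - n) ≠ 0 := by
    by_contra! hall
    exact hq (finsum_eq_zero_of_forall_eq_zero hall)
  have : q - n = -1 / (p : ℚ) ^ (j + 1) := HahnSeries.support_single_subset hj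
  refine ⟨j, ?_⟩
  simp only [delta]
  linear_combination this

/-- The summable family `n ↦ t^n s_n`. -/
def seriesFamily (p : ℕ) [Fact p.Prime] (F : Type*) [Field F] :
    HahnSeries.SummableFamily ℚ F ℕ where
  toFun n := HahnSeries.single (n : ℚ) (1 : F) * layer p F n
  isPWO_iUnion_support' := by
    refine (isPWO_range_delta p).mono (Set.iUnion_subset fun n q hq => ?_)
    obtain ⟨j, rfl⟩ := support_shift_layer p F n hq
    exact ⟨(n, j), rfl⟩
  finite_co_support' q := by
    refine Set.Subsingleton.finite fun n hn m hm => ?_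
    obtain ⟨i, hi⟩ := support_shift_layer p F n hn
    obtain ⟨j, hj⟩ := support_shift_layer p F m hm
    exact (delta_eq_imp p (hi.symm.trans hj)).1

/-- `s = ∑_{n ≥ 0} t^n s_n`. -/
def series (p : ℕ) [Fact p.Prime] (F : Type*) [Field F] : Hahn F := (seriesFamily p F).hsum

/-- `s_{n,i}`, the truncation of `s` to the exponents smaller than `δ(n, i)`. -/
def trunc (p : ℕ) [Fact p.Prime] (F : Type*) [Field F] (n i : ℕ) : Hahn F :=
  HahnSeries.truncLT (delta p n i) (series p F)

end MinPair

end

noncomputable section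

namespace MinPair

open HahnSeries

/-! ### Frobenius on Hahn series. -/

section Frobenius

variable {F : Type*} [Field F]

/-! Upper bound. Frobenius multiplies exponents by p, so Pascal's rule becomes an Artin–Schreier
tower: s_0^p - s_0 = t^(-1) and s_{m+1}^p - s_{m+1} = s_m (`layer_zero_pow`, `layer_succ_pow`). The
exponents of t^m s_m lie strictly between m - 1 and m, so s_{n,i} is σ = ∑_{m<n} t^m s_m plus
finitely many Puiseux monomials. It lies in the first n steps of the tower, hence has degree at most
p^n (`natDegree_minpoly_le`).

Lower bound, with n = k + 1. Every conjugation over K translates each s_m by a constant of F. If s_k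
had fewer than p^n translations, they would form an 𝔽_p-space of dimension < n, on which the first n
iterates of x ↦ x^p - x are F-linearly dependent. Applying this relation to s_k gives a nontrivial
F-combination of s_0, …, s_k fixed by the Galois group, hence in K because K is perfect
(`exists_conjugates`). But the exponents of such a combination have unbounded powers of p in their
denominators (`eq_zero_of_sum_layer_mem_puiseux`).

Two conjugations that translate s_k differently send σ to elements whose difference ∑ t^m e_m has
e_k ≠ 0, so valuation at most k. Any b in the ball has v(b - σ) > k, and conjugations preserve the
valuation because it is the unique extension from the complete field F((t)). They therefore send b
to different conjugates, as in Krasner's lemma (`pow_le_natDegree_minpoly`). -/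

theorem support_pow_lt {x : Hahn F} {r : ℚ} (h : ∀ q ∈ x.support, q < r) (k : ℕ) :
    ∀ q ∈ (x ^ (k + 1)).support, q < (k + 1 : ℕ) * r := by
  induction k with
  | zero => simpa using h
  | succ k ih =>
    intro q hq
    rw [pow_succ] at hq
    obtain ⟨a, ha, b, hb, rfl⟩ := Set.mem_add.mp (support_mul_subset hq)
    have := ih a ha
    have := h b hb
    push_cast at *
    linarith

theorem lt_support_pow {x : Hahn F} {r : ℚ} (h : ∀ q ∈ x.support, r < q) (k : ℕ) :
    ∀ q ∈ (x ^ (k + 1)).support, (k + 1 : ℕ) * r < q := by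
  induction k with
  | zero => simpa using h
  | succ k ih =>
    intro q hq
    rw [pow_succ] at hq
    obtain ⟨a, ha, b, hb, rfl⟩ := Set.mem_add.mp (support_mul_subset hq)
    have := ih a ha
    have := h b hb
    push_cast at *
    linarith

instance charP_hahn (p : ℕ) [CharP F p] : CharP (Hahn F) p :=
  charP_of_injective_ringHom (HahnSeries.C_injective (Γ := ℚ) (R := F)) p

/-- Frobenius acts on the coefficients of a Hahn series and scales the exponents by `p`. -/
theorem coeff_pow_char (p : ℕ) [hp : Fact p.Prime] [CharP F p] (x : Hahn F) (q : ℚ) :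
    (x ^ p).coeff q = (x.coeff (q / p)) ^ p := by
  obtain ⟨k, hk⟩ : ∃ k, p = k + 1 := ⟨p - 1, by have := hp.out.pos; omega⟩
  have hp0 : (p : ℚ) ≠ 0 := by exact_mod_cast hp.out.ne_zero
  set r := q / p with hr
  have hpr : ((k + 1 : ℕ) : ℚ) * r = q := by rw [← hk, hr]; field_simp
  -- Cut x at the exponent r = q / p. Frobenius is additive, and p-th powers of the parts below and
  -- above r stay strictly below and above p * r = q, so only the middle monomial contributes.
  set y := truncLT r x with hy
  set z := x - y - single r (x.coeff r) with hz
  have hx : x = y + single r (x.coeff r) + z := by rw [hz]; ring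
  have h1 : ((y : Hahn F) ^ p).coeff q = 0 := by
    by_contra hne
    have hlt : ∀ a ∈ y.support, a < r := fun a ha => by
      rw [hy, support_truncLT] at ha
      exact ha.2
    have := support_pow_lt hlt k q (by rwa [← hk])
    linarith
  have h2 : ((z : Hahn F) ^ p).coeff q = 0 := by
    by_contra hne
    have hlt : ∀ a ∈ z.support, r < a := fun a ha => by
      by_contra hle
      apply ha
      rcases lt_or_eq_of_le (not_lt.mp hle) with h | h
      · simp [hz, hy, coeff_truncLT_of_lt h, coeff_single_of_ne h.ne]
      · subst h
        simp [hz, hy, coeff_truncLT_of_le le_rfl]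
    have := lt_support_pow hlt k q (by rwa [← hk])
    linarith
  have h3 : ((single r (x.coeff r) : Hahn F) ^ p).coeff q = (x.coeff r) ^ p := by
    rw [single_pow]
    have : p • r = q := by rw [nsmul_eq_mul, ← hpr, ← hk]
    rw [this, coeff_single_same]
  conv_lhs => rw [hx]
  rw [add_pow_char, add_pow_char, coeff_add, coeff_add, h1, h2, h3, zero_add, add_zero]

end Frobenius

/-! ### Coefficients of s_n, of s and of its truncations. -/

section Coefficients

variable (p : ℕ) [hp : Fact p.Prime] (F : Type*) [Field F]

theorem coeff_shift_layer (n m j : ℕ) :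
    (single (n : ℚ) (1 : F) * layer p F n).coeff (delta p m j) =
      if m = n then ((j.choose n : ℕ) : F) else 0 := by
  have key (i : ℕ) : delta p m j - n = -1 / (p : ℚ) ^ (i + 1) ↔ m = n ∧ j = i := by
    constructor
    · intro h
      refine delta_eq_imp p ?_
      simp only [delta] at h ⊢
      linear_combination h
    · rintro ⟨rfl, rfl⟩
      simp only [delta]
      ring
  rw [coeff_single_mul, one_mul, layer, SummableFamily.coeff_hsum]
  have hterm (i : ℕ) : (layerFamily p F n i).coeff (delta p m j - n) =
      if m = n ∧ j = i then ((i.choose n : ℕ) : F) else 0 := by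
    change (single (-1 / (p : ℚ) ^ (i + 1)) ((i.choose n : ℕ) : F)).coeff _ = _
    rw [coeff_single]
    simp only [key]
  split_ifs with hmn
  · rw [finsum_eq_single _ j, hterm]
    · simp [hmn]
    · intro i hi
      rw [hterm, if_neg (fun h => hi h.2.symm)]
  · exact finsum_eq_zero_of_forall_eq_zero fun i => by
      rw [hterm, if_neg (fun h => hmn h.1)]

theorem coeff_layer (n j : ℕ) :
    (layer p F n).coeff (-1 / (p : ℚ) ^ (j + 1)) = ((j.choose n : ℕ) : F) := by
  have h := coeff_shift_layer p F n n j
  rw [if_pos rfl, coeff_single_mul, one_mul] at h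
  rw [← h]
  congr 1
  simp only [delta]
  ring

theorem exists_of_coeff_layer_ne_zero {n : ℕ} {q : ℚ} (h : (layer p F n).coeff q ≠ 0) :
    ∃ j : ℕ, q = -1 / (p : ℚ) ^ (j + 1) := by
  obtain ⟨j, hj⟩ := support_shift_layer p F n (q := q + n) (by
    rwa [coeff_single_mul, one_mul, add_sub_cancel_right])
  refine ⟨j, ?_⟩
  simp only [delta] at hj
  linear_combination hj

/-- The boundary exponent of the Frobenius recursion; `p ^ 0` is kept so that it matches the case j
= 0 there. -/
theorem coeff_layer_neg_one (n : ℕ) : (layer p F n).coeff (-1 / (p : ℚ) ^ 0) = 0 := by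
  have hp1 : (1 : ℚ) < p := by exact_mod_cast hp.out.one_lt
  by_contra hne
  obtain ⟨j, hj⟩ := exists_of_coeff_layer_ne_zero p F hne
  have h2 : 1 / (p : ℚ) ^ (j + 1) < 1 := by
    rw [div_lt_one (by positivity)]
    exact one_lt_pow₀ hp1 (by omega)
  rw [pow_zero, neg_div, neg_div] at hj
  linarith

theorem coeff_series (n j : ℕ) :
    (series p F).coeff (delta p n j) = ((j.choose n : ℕ) : F) := by
  rw [series, SummableFamily.coeff_hsum, finsum_eq_single _ n]
  · exact (coeff_shift_layer p F n n j).trans (if_pos rfl)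
  · intro m hm
    exact (coeff_shift_layer p F m n j).trans (if_neg hm.symm)

theorem exists_of_coeff_series_ne_zero {q : ℚ} (h : (series p F).coeff q ≠ 0) :
    ∃ n j : ℕ, q = delta p n j := by
  rw [series, SummableFamily.coeff_hsum] at h
  obtain ⟨n, hn⟩ : ∃ n, (seriesFamily p F n).coeff q ≠ 0 := by
    by_contra! hall
    exact h (finsum_eq_zero_of_forall_eq_zero hall)
  exact ⟨n, support_shift_layer p F n hn⟩

/-- The partial sum `∑_{m < n} t^m s_m` of the series `s`. -/
def partialSum (n : ℕ) : Hahn F :=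
  ∑ m ∈ Finset.range n, single (m : ℚ) (1 : F) * layer p F m

theorem coeff_partialSum (n m j : ℕ) :
    (partialSum p F n).coeff (delta p m j) = if m < n then ((j.choose m : ℕ) : F) else 0 := by
  rw [partialSum, coeff_sum]
  simp only [coeff_shift_layer]
  simp

theorem exists_of_coeff_partialSum_ne_zero {n : ℕ} {q : ℚ} (h : (partialSum p F n).coeff q ≠ 0) :
    ∃ m j : ℕ, q = delta p m j := by
  rw [partialSum, coeff_sum] at h
  obtain ⟨m, -, hm⟩ := Finset.exists_ne_zero_of_sum_ne_zero h
  exact ⟨m, support_shift_layer p F m hm⟩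

/-- All δ(m, j) lie strictly between m - 1 and m. Cutting at δ(n, i) thus keeps the layers m < n
whole and drops those with m > n; within layer n, δ increases with j. -/
theorem exists_of_coeff_trunc_sub_ne_zero {n i : ℕ} {q : ℚ}
    (h : (trunc p F n i - partialSum p F n).coeff q ≠ 0) :
    ∃ j < i, q = delta p n j := by
  obtain ⟨m, j, rfl⟩ : ∃ m j : ℕ, q = delta p m j := by
    by_cases h1 : (partialSum p F n).coeff q = 0
    · refine exists_of_coeff_series_ne_zero p F fun h2 => h ?_
      rw [coeff_sub, h1, trunc, HahnSeries.coeff_truncLT, h2]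
      simp
    · exact exists_of_coeff_partialSum_ne_zero p F h1
  rw [coeff_sub, trunc, HahnSeries.coeff_truncLT, coeff_series, coeff_partialSum] at h
  have b1 := delta_bounds p m j
  have b2 := delta_bounds p n i
  rcases lt_trichotomy m n with hmn | rfl | hmn
  · have : (m : ℚ) + 1 ≤ n := by exact_mod_cast hmn
    rw [if_pos (by linarith), if_pos hmn, sub_self] at h
    exact absurd rfl h
  · refine ⟨j, ?_, rfl⟩
    by_contra hij
    rw [if_neg (not_lt.mpr ((delta_strictMono p m).monotone (not_lt.mp hij))), if_neg (lt_irrefl m),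
      sub_self] at h
    exact h rfl
  · have : (n : ℚ) + 1 ≤ m := by exact_mod_cast hmn
    rw [if_neg (by linarith), if_neg hmn.not_gt, sub_self] at h
    exact absurd rfl h

theorem trunc_sub_mem_puiseux (n i : ℕ) : trunc p F n i - partialSum p F n ∈ puiseux F := by
  have hp0 : (p : ℚ) ≠ 0 := by exact_mod_cast hp.out.ne_zero
  refine ⟨⟨p ^ i, pow_pos hp.out.pos i⟩, (mem_range_ramify _ _).mpr fun q hq => ?_⟩
  obtain ⟨j, hj, rfl⟩ := exists_of_coeff_trunc_sub_ne_zero p F hq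
  obtain ⟨d, rfl⟩ := Nat.exists_eq_add_of_le hj
  refine ⟨n * p ^ (j + 1 + d) - p ^ d, ?_⟩
  simp only [delta, PNat.mk_coe]
  push_cast
  have e : (p : ℚ) ^ (j + 1 + d) = p ^ (j + 1) * p ^ d := _root_.pow_add _ _ _
  rw [Nat.succ_eq_add_one, e]
  field_simp

end Coefficients

/-! ### The Artin–Schreier relations. -/

section Relations

variable (p : ℕ) [hp : Fact p.Prime] (F : Type*) [Field F] [CharP F p]

/-- All coefficients of s_0 are 1, and Frobenius moves -1/p^(j+1) to -1/p^j; the only new exponent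
is -1, from j = 0. -/
theorem layer_zero_pow : layer p F 0 ^ p = layer p F 0 + single (-1 : ℚ) (1 : F) := by
  have hp0 : (p : ℚ) ≠ 0 := by exact_mod_cast hp.out.ne_zero
  have hp1 : (1 : ℚ) < p := by exact_mod_cast hp.out.one_lt
  ext q
  rw [coeff_pow_char, coeff_add]
  by_cases h : ∃ j : ℕ, q = -1 / (p : ℚ) ^ j
  · obtain ⟨j, rfl⟩ := h
    have e : -1 / (p : ℚ) ^ j / p = -1 / (p : ℚ) ^ (j + 1) := by rw [pow_succ]; field_simp
    rw [e, coeff_layer]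
    cases j with
    | zero =>
      rw [coeff_layer_neg_one]
      simp
    | succ j =>
      have hne : -1 / (p : ℚ) ^ (j + 1) ≠ -1 := by
        have h2 : 1 / (p : ℚ) ^ (j + 1) < 1 := by
          rw [div_lt_one (by positivity)]
          exact one_lt_pow₀ hp1 (by omega)
        intro h
        rw [neg_div] at h
        linarith
      rw [coeff_layer, coeff_single_of_ne hne]
      simp
  · have h1 : (layer p F 0).coeff (q / p) = 0 := by
      by_contra hne
      obtain ⟨j, hj⟩ := exists_of_coeff_layer_ne_zero p F hne
      refine h ⟨j, ?_⟩
      rw [div_eq_iff hp0] at hj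
      rw [hj, pow_succ]
      field_simp
    have h2 : (layer p F 0).coeff q = 0 := by
      by_contra hne
      obtain ⟨j, hj⟩ := exists_of_coeff_layer_ne_zero p F hne
      exact h ⟨j + 1, hj⟩
    have h3 : q ≠ -1 := fun hq => h ⟨0, by rw [hq]; simp⟩
    rw [h1, h2, coeff_single_of_ne h3, zero_pow hp.out.ne_zero, add_zero]

/-- Binomial coefficients lie in the prime field, so Frobenius only shifts j to j + 1, and the claim
is Pascal's rule. -/
theorem layer_succ_pow (n : ℕ) : layer p F (n + 1) ^ p = layer p F (n + 1) + layer p F n := by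
  have hp0 : (p : ℚ) ≠ 0 := by exact_mod_cast hp.out.ne_zero
  ext q
  rw [coeff_pow_char, coeff_add]
  by_cases h : ∃ j : ℕ, q = -1 / (p : ℚ) ^ j
  · obtain ⟨j, rfl⟩ := h
    have e : -1 / (p : ℚ) ^ j / p = -1 / (p : ℚ) ^ (j + 1) := by rw [pow_succ]; field_simp
    rw [e, coeff_layer]
    cases j with
    | zero =>
      rw [coeff_layer_neg_one, coeff_layer_neg_one]
      simp [hp.out.ne_zero]
    | succ j =>
      rw [coeff_layer, coeff_layer, ← frobenius_def, map_natCast, ← Nat.cast_add,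
        Nat.choose_succ_succ, add_comm]
  · have h1 : (layer p F (n + 1)).coeff (q / p) = 0 := by
      by_contra hne
      obtain ⟨j, hj⟩ := exists_of_coeff_layer_ne_zero p F hne
      refine h ⟨j, ?_⟩
      rw [div_eq_iff hp0] at hj
      rw [hj, pow_succ]
      field_simp
    have h2 (m : ℕ) : (layer p F m).coeff q = 0 := by
      by_contra hne
      obtain ⟨j, hj⟩ := exists_of_coeff_layer_ne_zero p F hne
      exact h ⟨j + 1, hj⟩
    rw [h1, h2, h2, zero_pow hp.out.ne_zero, add_zero]

end Relations

/-! ### The Newton–Puiseux field is perfect. -/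

section Perfect

variable (p : ℕ) [hp : Fact p.Prime] (F : Type*) [Field F] [CharP F p]

instance charP_puiseux : CharP (puiseux F) p :=
  (RingHom.charP_iff (puiseux F).subtype Subtype.val_injective p).mpr inferInstance

/-- Divide exponents by p and take p-th roots of coefficients; the common denominator grows from N
to N * p. -/
theorem exists_pow_eq_of_mem_puiseux [PerfectRing F p] {y : Hahn F} (hy : y ∈ puiseux F) :
    ∃ z ∈ puiseux F, z ^ p = y := by
  have hp0 : (0 : ℚ) < p := by exact_mod_cast hp.out.pos
  obtain ⟨N, hN⟩ := hy
  rw [mem_range_ramify] at hN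
  let g : ℚ ↪o ℚ := (OrderIso.divRight₀ (p : ℚ) hp0).toOrderEmbedding
  have hg (a : ℚ) : g a = a / p := rfl
  let z : Hahn F := embDomain g (y.map (frobeniusEquiv F p).symm)
  let P : ℕ+ := ⟨p, hp.out.pos⟩
  have hP : ((P : ℕ) : ℚ) = p := rfl
  refine ⟨z, ⟨N * P, (mem_range_ramify _ _).mpr fun q hq => ?_⟩, ?_⟩
  · obtain ⟨a, ha, rfl⟩ := support_embDomain_subset hq
    have ha' : a ∈ y.support := fun h0 => ha (by simp [HahnSeries.map, h0])
    obtain ⟨k, hk⟩ := hN a ha'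
    refine ⟨k, ?_⟩
    rw [hg, hk]
    rw [PNat.mul_coe, Nat.cast_mul, hP]
    field_simp
  · ext q
    have : z.coeff (q / p) = (frobeniusEquiv F p).symm (y.coeff q) := by
      rw [← hg, embDomain_coeff]
      rfl
    rw [coeff_pow_char, this, frobeniusEquiv_symm_pow_p]

theorem perfectField_puiseux [PerfectRing F p] : PerfectField (puiseux F) := by
  have : PerfectRing (puiseux F) p := PerfectRing.ofSurjective _ p fun y => by
    obtain ⟨z, hz, hzy⟩ := exists_pow_eq_of_mem_puiseux p F y.2
    exact ⟨⟨z, hz⟩, Subtype.ext hzy⟩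
  exact PerfectRing.toPerfectField _ p

end Perfect

/-! ### Linear independence of the s_m modulo K. -/

section Independence

/-- By Pascal's rule, the difference of the relations at j + 1 and j is a relation of the same kind
without c 0 and with the indices lowered by one. -/
theorem eq_zero_of_sum_choose_eq_zero {R : Type*} [CommRing R] (N n : ℕ) (c : ℕ → R)
    (h : ∀ j ≥ N, ∑ m ∈ Finset.range n, c m * ((j.choose m : ℕ) : R) = 0) :
    ∀ m < n, c m = 0 := by
  induction n generalizing c with
  | zero => simp
  | succ n ih =>
    have hs : ∀ m < n, c (m + 1) = 0 := by
      refine ih (fun m => c (m + 1)) fun j hj => ?_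
      have h1 := h j hj
      have h2 := h (j + 1) (by omega)
      rw [Finset.sum_range_succ'] at h1 h2
      simp only [Nat.choose_succ_succ, Nat.cast_add, mul_add, Finset.sum_add_distrib] at h2
      simp only [Nat.choose_zero_right] at h1 h2
      linear_combination h2 - h1
    intro m hm
    cases m with
    | succ m => exact hs m (by omega)
    | zero =>
      have h1 := h N le_rfl
      rw [Finset.sum_range_succ', Finset.sum_eq_zero] at h1
      · simpa using h1
      · intro m hm
        rw [hs m (Finset.mem_range.mp hm), zero_mul]

/-- If the support lies in (1/N)ℤ, the coefficient at -1/p^(j+1) vanishes for every j ≥ N, since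
p^(j+1) > N cannot divide N. -/
theorem eq_zero_of_sum_layer_mem_puiseux (p : ℕ) [hp : Fact p.Prime] (F : Type*) [Field F] (n : ℕ)
    (c : ℕ → F) (h : ∑ m ∈ Finset.range n, HahnSeries.C (c m) * layer p F m ∈ puiseux F) :
    ∀ m < n, c m = 0 := by
  obtain ⟨N, hN⟩ := h
  rw [mem_range_ramify] at hN
  refine eq_zero_of_sum_choose_eq_zero N n c fun j hj => ?_
  have hp0 : (p : ℚ) ≠ 0 := by exact_mod_cast hp.out.ne_zero
  have hN0 : ((N : ℕ) : ℚ) ≠ 0 := by exact_mod_cast N.pos.ne'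
  by_contra hne
  obtain ⟨k, hk⟩ := hN (-1 / (p : ℚ) ^ (j + 1)) (by
    rw [mem_support, coeff_sum]
    simpa only [HahnSeries.C_apply, coeff_single_zero_mul, coeff_layer] using hne)
  have h1 : ((N : ℕ) : ℤ) = -k * (p : ℤ) ^ (j + 1) := by
    field_simp at hk
    have : ((N : ℕ) : ℚ) = -k * (p : ℚ) ^ (j + 1) := by linear_combination -hk
    exact_mod_cast this
  have h2 : p ^ (j + 1) ∣ (N : ℕ) := by
    have : ((p ^ (j + 1) : ℕ) : ℤ) ∣ ((N : ℕ) : ℤ) := ⟨-k, by rw [h1]; push_cast; ring⟩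
    exact_mod_cast this
  have h3 := Nat.le_of_dvd N.pos h2
  have h4 : j + 1 < p ^ (j + 1) := Nat.lt_pow_self hp.out.one_lt
  omega

end Independence

/-! ### The valuation as a real absolute value. -/

section AbsoluteValue

variable (F : Type*) [Field F]

open Classical in
/-- The absolute value `|x| = 2^(-v(x))` on the Hahn field. -/
def hahnAbs : AbsoluteValue (Hahn F) ℝ where
  toFun x := if x = 0 then 0 else (2 : ℝ) ^ (-(x.order : ℝ))
  map_mul' x y := by
    by_cases hx : x = 0
    · simp [hx]
    by_cases hy : y = 0
    · simp [hy]
    rw [if_neg hx, if_neg hy, if_neg (mul_ne_zero hx hy), order_mul hx hy, Rat.cast_add, neg_add,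
      Real.rpow_add two_pos]
  nonneg' x := by
    split_ifs
    · exact le_rfl
    · positivity
  eq_zero' x := by
    constructor
    · intro h
      by_contra hx
      rw [if_neg hx] at h
      exact (Real.rpow_pos_of_pos two_pos _).ne' h
    · rintro rfl
      simp
  add_le' x y := by
    by_cases hx : x = 0
    · simp [hx]
    by_cases hy : y = 0
    · simp [hy]
    by_cases hxy : x + y = 0
    · rw [if_pos hxy, if_neg hx, if_neg hy]
      positivity
    rw [if_neg hx, if_neg hy, if_neg hxy]
    have h := min_order_le_order_add hxy
    have h1 := Real.rpow_pos_of_pos two_pos (-(x.order : ℝ))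
    have h2 := Real.rpow_pos_of_pos two_pos (-(y.order : ℝ))
    rcases min_le_iff.mp h with h | h
    · have : (2 : ℝ) ^ (-((x + y).order : ℝ)) ≤ 2 ^ (-(x.order : ℝ)) :=
        Real.rpow_le_rpow_of_exponent_le one_le_two (neg_le_neg (by exact_mod_cast h))
      linarith
    · have : (2 : ℝ) ^ (-((x + y).order : ℝ)) ≤ 2 ^ (-(y.order : ℝ)) :=
        Real.rpow_le_rpow_of_exponent_le one_le_two (neg_le_neg (by exact_mod_cast h))
      linarith

variable {F}

theorem hahnAbs_of_ne_zero {x : Hahn F} (hx : x ≠ 0) : hahnAbs F x = 2 ^ (-(x.order : ℝ)) :=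
  if_neg hx

theorem le_hahnAbs_of_coeff_ne_zero {x : Hahn F} {q : ℚ} (h : x.coeff q ≠ 0) :
    (2 : ℝ) ^ (-(q : ℝ)) ≤ hahnAbs F x := by
  rw [hahnAbs_of_ne_zero (ne_zero_of_coeff_ne_zero h)]
  have := order_le_of_coeff_ne_zero h
  exact Real.rpow_le_rpow_of_exponent_le one_le_two (neg_le_neg (by exact_mod_cast this))

theorem hahnAbs_le_of_forall_le {x : Hahn F} {r : ℚ} (h : ∀ q, x.coeff q ≠ 0 → r ≤ q) :
    hahnAbs F x ≤ 2 ^ (-(r : ℝ)) := by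
  by_cases hx : x = 0
  · rw [hx, map_zero]
    positivity
  · rw [hahnAbs_of_ne_zero hx]
    have := h _ (coeff_order_eq_zero.not.mpr hx)
    exact Real.rpow_le_rpow_of_exponent_le one_le_two (neg_le_neg (by exact_mod_cast this))

theorem hahnAbs_le_of_le_v {x : Hahn F} {r : ℚ} (h : (r : WithTop ℚ) ≤ v F x) :
    hahnAbs F x ≤ 2 ^ (-(r : ℝ)) :=
  hahnAbs_le_of_forall_le fun _ hq => WithTop.coe_le_coe.mp
    (h.trans (addVal_le_of_coeff_ne_zero hq))

theorem hahnAbs_add_le_max (x y : Hahn F) :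
    hahnAbs F (x + y) ≤ max (hahnAbs F x) (hahnAbs F y) := by
  by_cases hxy : x + y = 0
  · rw [hxy, map_zero]
    exact le_max_of_le_left ((hahnAbs F).nonneg x)
  rw [hahnAbs_of_ne_zero hxy]
  have h := coeff_order_eq_zero.not.mpr hxy
  rw [coeff_add] at h
  by_cases hx : x.coeff (x + y).order = 0
  · rw [hx, zero_add] at h
    exact le_max_of_le_right (le_hahnAbs_of_coeff_ne_zero h)
  · exact le_max_of_le_left (le_hahnAbs_of_coeff_ne_zero hx)

end AbsoluteValue

/-! ### F((t)) is complete, and K is algebraic over it. -/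

section Laurent

/-- The field `F((t))` as a subfield of the Hahn field. -/
def laurent (F : Type*) [Field F] : Subfield (Hahn F) := (ramify F 1).fieldRange

variable {F : Type*} [Field F]

theorem mem_laurent {x : Hahn F} :
    x ∈ laurent F ↔ ∀ q, x.coeff q ≠ 0 → ∃ k : ℤ, q = k := by
  rw [laurent, mem_range_ramify]
  simp

theorem single_mem_laurent (k : ℤ) (a : F) : (single (k : ℚ) a : Hahn F) ∈ laurent F :=
  mem_laurent.mpr fun _ hq => ⟨k, support_single_subset hq⟩

theorem laurent_le_puiseux : laurent F ≤ puiseux F := fun _ hx => ⟨1, hx⟩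

instance : NormedField (laurent F) :=
  AbsoluteValue.toNormedField ((hahnAbs F).comp (f := (laurent F).subtype) Subtype.val_injective)

theorem norm_laurent (x : laurent F) : ‖x‖ = hahnAbs F (x : Hahn F) := rfl

instance : NontriviallyNormedField (laurent F) where
  non_trivial := by
    refine ⟨⟨single (-1 : ℚ) (1 : F), by exact_mod_cast single_mem_laurent (-1) (1 : F)⟩, ?_⟩
    rw [norm_laurent]
    refine lt_of_lt_of_le ?_ (le_hahnAbs_of_coeff_ne_zero (q := -1) ?_)
    · norm_num
    · simp

instance : IsUltrametricDist (laurent F) :=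
  IsUltrametricDist.isUltrametricDist_of_forall_norm_add_le_max_norm fun x y =>
    hahnAbs_add_le_max (x : Hahn F) y

instance : CompleteSpace (laurent F) := by
  refine Metric.complete_of_convergent_controlled_sequences (fun N => (2 : ℝ) ^ (-(N : ℝ)))
    (fun N => by positivity) fun u hu => ?_
  have hcoeff (N n m : ℕ) (hn : N ≤ n) (hm : N ≤ m) (q : ℚ) (hq : q ≤ N) :
      (u n : Hahn F).coeff q = (u m : Hahn F).coeff q := by
    by_contra hne
    have h1 := hu N n m hn hm
    rw [dist_eq_norm, norm_laurent] at h1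
    have h2 : ((u n - u m : laurent F) : Hahn F).coeff q ≠ 0 := by
      rw [Subfield.coe_sub, coeff_sub]
      exact sub_ne_zero.mpr hne
    have h3 := le_hahnAbs_of_coeff_ne_zero h2
    have h4 : (2 : ℝ) ^ (-(N : ℝ)) ≤ 2 ^ (-(q : ℝ)) :=
      Real.rpow_le_rpow_of_exponent_le one_le_two (neg_le_neg (by exact_mod_cast hq))
    linarith
  -- The coefficient at q no longer changes from index ⌈q⌉₊ on. For q ≤ 0 this index is 0, so the
  -- support lies in that of `u 0` together with ℕ.
  let x : Hahn F :=
    { coeff := fun q => (u ⌈q⌉₊ : Hahn F).coeff q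
      isPWO_support' := by
        have h1 : (Set.range fun k : ℕ => (k : ℚ)).IsPWO := by
          rw [← Set.image_univ]
          exact (Set.isPWO_of_wellQuasiOrderedLE _).image_of_monotone Nat.mono_cast
        refine ((u 0 : Hahn F).isPWO_support.union h1).mono fun q hq => ?_
        rcases le_or_gt q 0 with h0 | h0
        · left
          have : ⌈q⌉₊ = 0 := Nat.ceil_eq_zero.mpr h0
          simpa [this] using hq
        · right
          obtain ⟨k, rfl⟩ := mem_laurent.mp (u ⌈q⌉₊).2 q hq
          lift k to ℕ using by exact_mod_cast h0.le
          exact ⟨k, by simp⟩ }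
  have hx : x ∈ laurent F := mem_laurent.mpr fun q hq => mem_laurent.mp (u ⌈q⌉₊).2 q hq
  refine ⟨⟨x, hx⟩, tendsto_iff_dist_tendsto_zero.mpr ?_⟩
  have hlim : Filter.Tendsto (fun n : ℕ => ((2 : ℝ)⁻¹) ^ n) Filter.atTop (nhds 0) :=
    tendsto_pow_atTop_nhds_zero_of_lt_one (by norm_num) (by norm_num)
  refine squeeze_zero (fun _ => dist_nonneg) (fun n => ?_) hlim
  rw [dist_eq_norm, norm_laurent]
  refine (hahnAbs_le_of_forall_le (r := n) fun q hq => ?_).trans_eq ?_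
  · by_contra hlt
    have hqn : ⌈q⌉₊ ≤ n := Nat.ceil_le.mpr (not_le.mp hlt).le
    apply hq
    rw [Subfield.coe_sub, coeff_sub, sub_eq_zero]
    exact hcoeff ⌈q⌉₊ n ⌈q⌉₊ hqn le_rfl q (Nat.le_ceil q)
  · rw [Rat.cast_natCast, Real.rpow_neg two_pos.le, Real.rpow_natCast, inv_pow]

instance : Algebra (laurent F) (puiseux F) := (Subfield.inclusion laurent_le_puiseux).toAlgebra

instance : IsScalarTower (laurent F) (puiseux F) (Hahn F) := IsScalarTower.of_algebraMap_eq' rfl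

/-- The part of a Hahn series with exponents in `r + ℤ`. -/
def cosetPart (r : ℚ) (y : Hahn F) : Hahn F where
  coeff q := open Classical in if ∃ k : ℤ, q = r + k then y.coeff q else 0
  isPWO_support' := y.isPWO_support.mono fun q hq => by
    simp only [Function.mem_support, ne_eq, ite_eq_right_iff, Classical.not_imp] at hq
    exact hq.2

theorem single_neg_mul_cosetPart_mem (r : ℚ) (y : Hahn F) :
    single (-r) (1 : F) * cosetPart r y ∈ laurent F := by
  refine mem_laurent.mpr fun q hq => ?_
  rw [coeff_single_mul, one_mul] at hq
  by_contra hk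
  refine hq (if_neg ?_)
  rintro ⟨k, h⟩
  exact hk ⟨k, by linarith⟩

theorem isAlgebraic_single (k : ℤ) (N : ℕ) (hN : 0 < N) :
    IsAlgebraic (laurent F) (single ((k : ℚ) / N) (1 : F)) := by
  refine IsAlgebraic.of_pow hN ?_
  have : single ((k : ℚ) / N) (1 : F) ^ N =
      algebraMap (laurent F) (Hahn F) ⟨_, single_mem_laurent k (1 : F)⟩ := by
    have hN' : (N : ℚ) ≠ 0 := by exact_mod_cast hN.ne'
    rw [single_pow, one_pow, nsmul_eq_mul, mul_div_cancel₀ _ hN']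
    rfl
  rw [this]
  exact isAlgebraic_algebraMap _

theorem sum_cosetPart {N : ℕ} (hN : 0 < N) {y : Hahn F}
    (hy : ∀ q ∈ y.support, ∃ k : ℤ, q = k * (N : ℚ)⁻¹) :
    ∑ i ∈ Finset.range N, cosetPart ((i : ℚ) / N) y = y := by
  have hN' : (N : ℚ) ≠ 0 := by exact_mod_cast hN.ne'
  ext q
  rw [coeff_sum]
  by_cases hq : y.coeff q = 0
  · rw [hq]
    refine Finset.sum_eq_zero fun i _ => ?_
    simp [cosetPart, hq]
  · obtain ⟨k, rfl⟩ := hy q hq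
    have key (i : ℕ) : (∃ m : ℤ, (k : ℚ) * (N : ℚ)⁻¹ = (i : ℚ) / N + m) ↔ ∃ m : ℤ, k = i + N * m := by
      refine exists_congr fun m => ?_
      field_simp
      norm_cast
    have hk0 := Int.emod_nonneg k (b := N) (by omega)
    have hk1 := Int.emod_lt_of_pos k (b := N) (by omega)
    rw [Finset.sum_eq_single (k % N).toNat]
    · refine if_pos ((key _).mpr ⟨k / N, ?_⟩)
      rw [Int.toNat_of_nonneg hk0, Int.emod_add_mul_ediv]
    · intro i hi hne
      refine if_neg fun h => hne ?_
      obtain ⟨m, hm⟩ := (key i).mp h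
      rw [hm, Int.add_mul_emod_self_left, Int.emod_eq_of_lt (by omega)
        (by have := Finset.mem_range.mp hi; omega), Int.toNat_natCast]
    · intro h
      exact absurd (Finset.mem_range.mpr (by omega)) h

/-- A series with exponents in (1/N)ℤ splits by exponent class modulo ℤ into N pieces, each of the
form t^(i/N) times a Laurent series. -/
instance : Algebra.IsAlgebraic (laurent F) (puiseux F) where
  isAlgebraic x := by
    refine (isAlgebraic_algebraMap_iff (A := Hahn F) Subtype.val_injective).mp ?_
    obtain ⟨y, N, hN⟩ := x
    rw [mem_range_ramify] at hN
    change IsAlgebraic (laurent F) y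
    rw [← mem_algebraicClosure_iff, ← sum_cosetPart N.pos hN]
    refine sum_mem fun i _ => ?_
    have h1 : single ((i : ℚ) / N) (1 : F) ∈ algebraicClosure (laurent F) (Hahn F) :=
      mem_algebraicClosure_iff.mpr (by simpa using isAlgebraic_single (F := F) i N N.pos)
    have h2 : cosetPart ((i : ℚ) / N) y =
        single ((i : ℚ) / N) (1 : F) * (single (-((i : ℚ) / N)) (1 : F) * cosetPart ((i : ℚ) / N) y) := by
      rw [← mul_assoc, single_mul_single]
      simp
    rw [h2]
    exact mul_mem h1 ((algebraicClosure (laurent F) (Hahn F)).algebraMap_mem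
      ⟨_, single_neg_mul_cosetPart_mem _ _⟩)

end Laurent

/-! ### Conjugates in an Artin–Schreier tower. -/

section ArtinSchreier

variable (p : ℕ) [hp : Fact p.Prime]

/-- The Artin–Schreier map `x ↦ x ^ p - x` of a commutative ring of characteristic `p`. -/
def artinSchreier (R : Type*) [CommRing R] [CharP R p] : R →+ R :=
  (frobenius R p : R →+ R) - AddMonoidHom.id R

theorem artinSchreier_apply {R : Type*} [CommRing R] [CharP R p] (x : R) :
    artinSchreier p R x = x ^ p - x := rfl

theorem map_artinSchreier_iterate {R S : Type*} [CommRing R] [CharP R p] [CommRing S] [CharP S p]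
    (f : R →+* S) (l : ℕ) (x : R) :
    f ((artinSchreier p R)^[l] x) = (artinSchreier p S)^[l] (f x) :=
  Function.Semiconj.iterate_right (f := f) (fun x => by simp [artinSchreier_apply]) l x

/-- Fewer than `p ^ n` elements forming a group satisfy a common nontrivial relation between the
first `n` iterates of the Artin–Schreier map. -/
theorem exists_sum_artinSchreier_iterate_eq_zero {F : Type*} [Field F] [CharP F p]
    (B : AddSubgroup F) [Finite B] {n : ℕ} (h : Nat.card B < p ^ n) :
    ∃ c : ℕ → F, (∃ m < n, c m ≠ 0) ∧
      ∀ a ∈ B, ∑ l ∈ Finset.range n, c l * (artinSchreier p F)^[l] a = 0 := by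
  let : Algebra (ZMod p) F := ZMod.algebra F p
  let V : Submodule (ZMod p) F := AddSubgroup.toZModSubmodule p B
  have hfin : Finite V := ‹Finite B›
  have hcard : Nat.card V = p ^ Module.finrank (ZMod p) V := by
    rw [Module.natCard_eq_pow_finrank (K := ZMod p), Nat.card_zmod]
  have hlt : Module.finrank (ZMod p) V < n := by
    refine (Nat.pow_lt_pow_iff_right hp.out.one_lt).mp ?_
    rw [← hcard]
    exact h
  let w : F →ₗ[ZMod p] F := (artinSchreier p F).toZModLinearMap p
  let e : Fin n → V →ₗ[ZMod p] F := fun l => (w ^ (l : ℕ)).domRestrict V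
  -- The 𝔽_p-linear maps V → F form an F-space of dimension dim V < n, which contains the n maps `e
  -- l`.
  have hdep : ¬ LinearIndependent F e := fun hli => by
    have := hli.fintype_card_le_finrank
    rw [Module.finrank_linearMap_self, Fintype.card_fin] at this
    omega
  obtain ⟨g, hg, i, hi⟩ := Fintype.not_linearIndependent_iff.mp hdep
  refine ⟨fun l => if hl : l < n then g ⟨l, hl⟩ else 0, ⟨i, i.2, by simpa using hi⟩, fun a ha => ?_⟩
  have h1 := LinearMap.congr_fun hg (⟨a, ha⟩ : V)
  rw [LinearMap.sum_apply] at h1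
  rw [Finset.sum_range]
  refine Eq.trans (Finset.sum_congr rfl fun l _ => ?_) h1
  have h2 : e l ⟨a, ha⟩ = (artinSchreier p F)^[l] a := Module.End.pow_apply w l a
  rw [LinearMap.smul_apply, smul_eq_mul, h2]
  simp

/-- Let `u 0, u 1, …` be an Artin–Schreier tower over `K` such that no nontrivial combination of
`u 0, …, u k` with coefficients in the algebraically closed field `F` lies in `K`. Then the
conjugates of `u k` differ from it by elements of `F`, and there are at least `p ^ (k + 1)`. -/
theorem exists_conjugates {F K Ω : Type*} [Field F] [Field K] [Field Ω] [IsAlgClosed F]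
    [CharP F p] [CharP Ω p] [Algebra F K] [Algebra F Ω] [Algebra K Ω] [IsScalarTower F K Ω]
    [IsGalois K Ω] (u : ℕ → Ω) (x : K) (hu0 : u 0 ^ p - u 0 = algebraMap K Ω x)
    (hu : ∀ m, u (m + 1) ^ p - u (m + 1) = u m) (k : ℕ)
    (hind : ∀ c : ℕ → F,
      ∑ m ∈ Finset.range (k + 1), algebraMap F Ω (c m) * u m ∈ Set.range (algebraMap K Ω) →
      ∀ m < k + 1, c m = 0) :
    (∀ (g : Gal(Ω/K)) (m : ℕ), ∃ a : F, g (u m) = u m + algebraMap F Ω a) ∧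
    ∃ B : Set F, B.Finite ∧ p ^ (k + 1) ≤ B.ncard ∧
      ∀ a ∈ B, ∃ g : Gal(Ω/K), g (u k) = u k + algebraMap F Ω a := by
  have hgF (g : Gal(Ω/K)) (a : F) : g (algebraMap F Ω a) = algebraMap F Ω a := by
    rw [IsScalarTower.algebraMap_apply F K Ω, AlgEquiv.commutes]
  -- Being algebraically closed, F contains every root in Ω of X^p - X - a.
  have hlift (y : Ω) (a : F) (h : y ^ p - y = algebraMap F Ω a) : ∃ b, y = algebraMap F Ω b := by
    have hp1 := hp.out.one_lt
    have hint : IsIntegral F y := by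
      refine ⟨Polynomial.X ^ p - (Polynomial.X + Polynomial.C a), ?_, ?_⟩
      · refine Polynomial.monic_X_pow_sub (lt_of_le_of_lt (Polynomial.degree_X_add_C a).le ?_)
        exact_mod_cast hp1
      · simp only [Polynomial.eval₂_sub, Polynomial.eval₂_add, Polynomial.eval₂_pow,
          Polynomial.eval₂_X, Polynomial.eval₂_C, ← h]
        ring
    obtain ⟨b, hb⟩ := (IsAlgClosed.algebraMap_bijective_of_isIntegral
      (k := F) (K := algebraicClosure F Ω)).2 ⟨y, mem_algebraicClosure_iff.mpr hint.isAlgebraic⟩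
    exact ⟨b, (congrArg Subtype.val hb).symm⟩
  have hshift (g : Gal(Ω/K)) (m : ℕ) : ∃ a : F, g (u m) = u m + algebraMap F Ω a := by
    induction m with
    | zero =>
      have h1 : g (u 0) ^ p - g (u 0) = u 0 ^ p - u 0 := by
        rw [← map_pow, ← map_sub, hu0, AlgEquiv.commutes]
      obtain ⟨b, hb⟩ := hlift (g (u 0) - u 0) 0 (by
        rw [sub_pow_char, map_zero]
        linear_combination h1)
      exact ⟨b, by rw [← hb]; ring⟩
    | succ m ih =>
      obtain ⟨a, ha⟩ := ih
      have h1 : g (u (m + 1)) ^ p - g (u (m + 1)) = u m + algebraMap F Ω a := by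
        rw [← map_pow, ← map_sub, hu, ha]
      obtain ⟨b, hb⟩ := hlift (g (u (m + 1)) - u (m + 1)) a (by
        rw [sub_pow_char]
        linear_combination h1 - hu m)
      exact ⟨b, by rw [← hb]; ring⟩
  refine ⟨hshift, ?_⟩
  let B : AddSubgroup F :=
    { carrier := {a | ∃ g : Gal(Ω/K), g (u k) = u k + algebraMap F Ω a}
      zero_mem' := ⟨1, by simp⟩
      add_mem' := by
        rintro a b ⟨g, hg⟩ ⟨h, hh⟩
        refine ⟨g * h, ?_⟩
        rw [AlgEquiv.mul_apply, hh, map_add, hg, hgF, map_add]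
        ring
      neg_mem' := by
        rintro a ⟨g, hg⟩
        refine ⟨g⁻¹, ?_⟩
        have h1 : g⁻¹ (g (u k)) = u k := by rw [← AlgEquiv.mul_apply]; simp
        rw [hg, map_add, hgF] at h1
        rw [map_neg, ← sub_eq_add_neg]
        exact eq_sub_of_add_eq h1 }
  have hfin : (B : Set F).Finite := by
    refine Set.Finite.of_finite_image (f := fun a => u k + algebraMap F Ω a)
      (((minpoly K (u k)).rootSet_finite Ω).subset ?_) fun a _ b _ hab =>
        (algebraMap F Ω).injective (add_left_cancel hab)
    rintro _ ⟨a, ⟨g, hg⟩, rfl⟩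
    have hint : IsIntegral K (u k) := Algebra.IsIntegral.isIntegral _
    rw [Polynomial.mem_rootSet]
    refine ⟨minpoly.ne_zero hint, ?_⟩
    change (Polynomial.aeval (u k + algebraMap F Ω a)) (minpoly K (u k)) = 0
    rw [← hg, ← minpoly.algEquiv_eq g (u k)]
    exact minpoly.aeval _ _
  refine ⟨B, hfin, ?_, fun a ha => ha⟩
  have : Finite B := hfin
  by_contra hlt
  rw [not_le, ← Nat.card_coe_set_eq] at hlt
  obtain ⟨c, ⟨m, hm, hcm⟩, hc⟩ := exists_sum_artinSchreier_iterate_eq_zero p B hlt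
  have hiter (l : ℕ) (hl : l ≤ k) : (artinSchreier p Ω)^[l] (u k) = u (k - l) := by
    induction l with
    | zero => rfl
    | succ l ih =>
      rw [Function.iterate_succ_apply', ih (by omega), artinSchreier_apply]
      obtain ⟨d, hd⟩ : ∃ d, k - l = d + 1 := ⟨k - l - 1, by omega⟩
      rw [hd, hu]
      congr 1
      omega
  -- An automorphism translates `u k` by some a ∈ B; the iterates are additive, so the sum changes
  -- by the relation evaluated at a, which is 0.
  have hfix : ∑ l ∈ Finset.range (k + 1), algebraMap F Ω (c l) * (artinSchreier p Ω)^[l] (u k) ∈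
      Set.range (algebraMap K Ω) := by
    rw [InfiniteGalois.mem_range_algebraMap_iff_fixed]
    intro g
    obtain ⟨a, ha⟩ := hshift g k
    have h1 := congrArg (algebraMap F Ω) (hc a ⟨g, ha⟩)
    rw [map_sum, map_zero] at h1
    rw [map_sum]
    rw [← add_zero (∑ l ∈ Finset.range (k + 1), algebraMap F Ω (c l) * _), ← h1,
      ← Finset.sum_add_distrib]
    refine Finset.sum_congr rfl fun l _ => ?_
    have h2 := map_artinSchreier_iterate p (g : Ω →+* Ω) l (u k)
    have h3 := map_artinSchreier_iterate p (algebraMap F Ω) l a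
    rw [map_mul, map_mul, hgF, h3]
    change _ * (g : Ω →+* Ω) _ = _
    rw [h2]
    change _ * (artinSchreier p Ω)^[l] (g (u k)) = _
    rw [ha, iterate_map_add, mul_add]
  refine hcm ?_
  -- The l-th iterate takes `u k` to `u (k - l)`, so the coefficients appear in reverse order.
  have := hind (fun m => c (k - m)) (by
    rw [← Finset.sum_range_reflect]
    convert hfix using 1
    refine Finset.sum_congr rfl fun l hl => ?_
    have hl' : l ≤ k := by have := Finset.mem_range.mp hl; omega
    rw [hiter l hl', show k + 1 - 1 - l = k - l by omega, Nat.sub_sub_self hl']) (k - m) (by omega)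
  rwa [Nat.sub_sub_self (by omega)] at this

end ArtinSchreier

/-! ### The Krasner-type lower bound. -/

section Krasner

/-- A Krasner-type bound: let `L` be algebraic over `K`, itself algebraic over a complete field `C`.
If `b` is closer to `∑ T m * u m` than its distinct conjugates are to each other, then it has at
least as many conjugates as `u k`. -/
theorem pow_le_natDegree_minpoly (p : ℕ) [hp : Fact p.Prime] {F C K L : Type*} [Field F]
    [NontriviallyNormedField C] [IsUltrametricDist C] [CompleteSpace C] [Field K] [Field L]
    [IsAlgClosed F] [CharP F p] [PerfectField K] [Algebra F K] [Algebra F L] [Algebra K L]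
    [IsScalarTower F K L] [Algebra C K] [Algebra C L] [IsScalarTower C K L]
    [Algebra.IsAlgebraic C K] [Algebra.IsAlgebraic K L] (f : AbsoluteValue L ℝ)
    (hf : ∀ y : C, f (algebraMap C L y) = ‖y‖) (u : ℕ → L) (x : K)
    (hu0 : u 0 ^ p - u 0 = algebraMap K L x)
    (hu : ∀ m, u (m + 1) ^ p - u (m + 1) = u m) (k : ℕ)
    (hind : ∀ c : ℕ → F,
      ∑ m ∈ Finset.range (k + 1), algebraMap F L (c m) * u m ∈ Set.range (algebraMap K L) →
      ∀ m < k + 1, c m = 0) (T : ℕ → K) (r : ℝ)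
    (hT : ∀ e : ℕ → F, e k ≠ 0 →
      r ≤ f (∑ m ∈ Finset.range (k + 1), algebraMap K L (T m) * algebraMap F L (e m)))
    (b : L) (hb : f (b - ∑ m ∈ Finset.range (k + 1), algebraMap K L (T m) * u m) < r) :
    p ^ (k + 1) ≤ (minpoly K b).natDegree := by
  let Ω := AlgebraicClosure L
  let ι := algebraMap L Ω
  have : CharP Ω p := charP_of_injective_algebraMap (algebraMap F Ω).injective p
  have : Algebra.IsAlgebraic K Ω := Algebra.IsAlgebraic.trans K L Ω
  have : Algebra.IsAlgebraic C L := Algebra.IsAlgebraic.trans C K L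
  have : Algebra.IsAlgebraic C Ω := Algebra.IsAlgebraic.trans C L Ω
  have : IsAlgClosure K Ω := ⟨inferInstance, inferInstance⟩
  have : IsGalois K Ω := {}
  let N := spectralNorm C Ω
  -- Over the complete field C, the extension of the norm to L is unique, so f is the spectral norm.
  have hN (y : L) : N (ι y) = f y := by
    rw [spectralNorm_unique_field_norm_ext hf y]
    exact (spectralNorm.eq_of_tower y).symm
  have hNg (g : Gal(Ω/K)) (y : Ω) : N (g y) = N y :=
    (spectralNorm_eq_of_equiv (g.restrictScalars C) y).symm
  obtain ⟨hshift, B, hBfin, hBcard, hB⟩ := exists_conjugates p (F := F) (K := K) (Ω := Ω)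
    (fun m => ι (u m)) x
    (by rw [← map_pow, ← map_sub, hu0]; exact (IsScalarTower.algebraMap_apply K L Ω x).symm)
    (fun m => by rw [← map_pow, ← map_sub, hu]) k (fun c hc => hind c (by
      obtain ⟨y, hy⟩ := hc
      refine ⟨y, ι.injective ?_⟩
      rw [map_sum]
      simp only [map_mul]
      rw [← IsScalarTower.algebraMap_apply K L Ω, hy]
      rfl))
  choose e he using hshift
  have hsum (g : Gal(Ω/K)) :
      g (ι (∑ m ∈ Finset.range (k + 1), algebraMap K L (T m) * u m)) =
      ι (∑ m ∈ Finset.range (k + 1), algebraMap K L (T m) * u m) +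
      ι (∑ m ∈ Finset.range (k + 1), algebraMap K L (T m) * algebraMap F L (e g m)) := by
    rw [← map_add, ← Finset.sum_add_distrib, map_sum, map_sum, map_sum]
    refine Finset.sum_congr rfl fun m _ => ?_
    have h1 : ι (algebraMap K L (T m)) = algebraMap K Ω (T m) :=
      (IsScalarTower.algebraMap_apply K L Ω _).symm
    have h2 : ι (algebraMap F L (e g m)) = algebraMap F Ω (e g m) :=
      (IsScalarTower.algebraMap_apply F L Ω _).symm
    rw [map_mul, map_mul, map_add, map_mul, map_mul, h1, h2, AlgEquiv.commutes, he, mul_add]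
  choose! G hG using hB
  have hek (a : F) (ha : a ∈ B) : e (G a) k = a :=
    (algebraMap F Ω).injective (add_left_cancel ((he (G a) k).symm.trans (hG a ha)))
  -- If `G a` and `G a'` agreed on b, the difference of their values at b - σ would be ∑ T m * (e' m
  -- - e m), of size at least r since its k-th entry a' - a is nonzero. Invariance and the
  -- ultrametric inequality bound it by f (b - σ) < r.
  have hinj : Set.InjOn (fun a => G a (ι b)) B := by
    intro a ha a' ha' hab
    by_contra hne
    set σ := ∑ m ∈ Finset.range (k + 1), algebraMap K L (T m) * u m with hσ
    have h1 : G a (ι (b - σ)) - G a' (ι (b - σ)) =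
        ι (∑ m ∈ Finset.range (k + 1),
          algebraMap K L (T m) * algebraMap F L (e (G a') m - e (G a) m)) := by
      simp only [map_sub, mul_sub, Finset.sum_sub_distrib]
      rw [hsum, hsum]
      have : G a (ι b) = G a' (ι b) := hab
      rw [this]
      ring
    have h2 := hT (fun m => e (G a') m - e (G a) m) (by
      simp only [hek a ha, hek a' ha']
      exact sub_ne_zero.mpr (Ne.symm hne))
    rw [← hN, ← h1] at h2
    have h3 : N (G a (ι (b - σ)) - G a' (ι (b - σ))) ≤ f (b - σ) := by
      have h4 := isNonarchimedean_spectralNorm (K := C) (L := Ω)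
        (G a (ι (b - σ))) (-(G a' (ι (b - σ))))
      rw [spectralNorm_neg (Algebra.IsAlgebraic.isAlgebraic _), ← sub_eq_add_neg] at h4
      refine h4.trans (le_of_eq ?_)
      change max (N _) (N _) = _
      rw [hNg, hNg, max_self, hN]
    linarith
  have hint : IsIntegral K b := Algebra.IsIntegral.isIntegral _
  calc p ^ (k + 1) ≤ B.ncard := hBcard
    _ = ((fun a => G a (ι b)) '' B).ncard := hinj.ncard_image.symm
    _ ≤ ((minpoly K b).rootSet Ω).ncard := by
      refine Set.ncard_le_ncard ?_ (Polynomial.rootSet_finite _ _)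
      rintro _ ⟨a, -, rfl⟩
      rw [Polynomial.mem_rootSet]
      refine ⟨minpoly.ne_zero hint, ?_⟩
      have h1 : minpoly K (G a (ι b)) = minpoly K b := by
        rw [minpoly.algEquiv_eq]
        exact minpoly.algebraMap_eq ι.injective b
      change (Polynomial.aeval (G a (ι b))) (minpoly K b) = 0
      rw [← h1]
      exact minpoly.aeval _ _
    _ ≤ (minpoly K b).natDegree := Polynomial.ncard_rootSet_le _ _

end Krasner

/-! ### The upper bound for the degree. -/

section Degree

/-- The top of an Artin–Schreier tower with `n` steps over `K` has degree at most `p ^ n`, and the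
same holds for all elements of the tower. -/
theorem natDegree_minpoly_le (p : ℕ) [hp : Fact p.Prime] {K L : Type*} [Field K] [Field L]
    [Algebra K L] (u : ℕ → L) (x : K) (hu0 : u 0 = algebraMap K L x)
    (hu : ∀ m, u (m + 1) ^ p - u (m + 1) = u m) (n : ℕ) (y : L)
    (hy : y ∈ IntermediateField.adjoin K (u '' Set.Iic n)) :
    IsIntegral K y ∧ (minpoly K y).natDegree ≤ p ^ n := by
  -- P is the n-th iterate of x ↦ x^p - x applied to X; it descends n steps in the tower.
  have hpoly (n : ℕ) : ∃ P : Polynomial K, P.Monic ∧ P.natDegree = p ^ n ∧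
      ∀ m, (Polynomial.aeval (u (m + n))) P = u m := by
    induction n with
    | zero => exact ⟨Polynomial.X, Polynomial.monic_X, by simp, fun m => by simp⟩
    | succ n ih =>
      obtain ⟨P, hP, hd, hm⟩ := ih
      have hdeg : P.degree < (P ^ p).degree := by
        rw [Polynomial.degree_pow, Polynomial.degree_eq_natDegree hP.ne_zero, hd, nsmul_eq_mul]
        have := hp.out.one_lt
        have h0 : 0 < p ^ n := pow_pos hp.out.pos n
        exact_mod_cast (lt_mul_iff_one_lt_left h0).mpr this
      refine ⟨P ^ p - P, (hP.pow p).sub_of_left hdeg, ?_, fun m => ?_⟩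
      · rw [Polynomial.natDegree_sub_eq_left_of_natDegree_lt
          (Polynomial.natDegree_lt_natDegree hP.ne_zero hdeg), Polynomial.natDegree_pow, hd,
          pow_succ, mul_comm]
      · have h1 := hm (m + 1)
        rw [show m + 1 + n = m + (n + 1) by ring] at h1
        rw [map_sub, map_pow, h1, hu]
  have hroot : ∃ P : Polynomial K, P.Monic ∧ P.natDegree = p ^ n ∧
      (Polynomial.aeval (u n)) P = 0 := by
    obtain ⟨P, hP, hd, hm⟩ := hpoly n
    have hpos : 0 < P.degree := by
      rw [← Polynomial.natDegree_pos_iff_degree_pos, hd]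
      exact pow_pos hp.out.pos n
    have hC : (Polynomial.C x).degree < P.degree := Polynomial.degree_C_le.trans_lt hpos
    refine ⟨P - Polynomial.C x, hP.sub_of_left hC, ?_, ?_⟩
    · rw [Polynomial.natDegree_sub_C, hd]
    · have h1 := hm 0
      rw [zero_add] at h1
      rw [map_sub, h1, Polynomial.aeval_C, hu0, sub_self]
  obtain ⟨P, hP, hd, hr⟩ := hroot
  have hint : IsIntegral K (u n) := ⟨P, hP, hr⟩
  -- The lower steps are polynomials in `u n`, so the top step alone generates the tower.
  have hle : IntermediateField.adjoin K (u '' Set.Iic n) ≤ IntermediateField.adjoin K {u n} := by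
    refine IntermediateField.adjoin_le_iff.mpr ?_
    rintro _ ⟨m, hm, rfl⟩
    obtain ⟨d, rfl⟩ := Nat.exists_eq_add_of_le (Set.mem_Iic.mp hm)
    obtain ⟨Q, -, -, hQ⟩ := hpoly d
    have h1 := IntermediateField.mem_adjoin_simple_self K (u (m + d))
    have h2 : (Polynomial.aeval (u (m + d))) Q ∈ IntermediateField.adjoin K {u (m + d)} :=
      IntermediateField.algebra_adjoin_le_adjoin _ _ (Polynomial.aeval_mem_adjoin_singleton _ _)
    rwa [hQ] at h2
  have hfd : FiniteDimensional K (IntermediateField.adjoin K {u n}) :=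
    IntermediateField.adjoin.finiteDimensional hint
  let z : IntermediateField.adjoin K {u n} := ⟨y, hle hy⟩
  have hz : minpoly K y = minpoly K z :=
    minpoly.algebraMap_eq (algebraMap (IntermediateField.adjoin K {u n}) L).injective z
  refine ⟨(Algebra.IsIntegral.isIntegral z).map (IntermediateField.val _), ?_⟩
  rw [hz]
  refine (minpoly.natDegree_le z).trans ?_
  rw [IntermediateField.adjoin.finrank hint, ← hd]
  exact Polynomial.natDegree_le_of_dvd (minpoly.dvd _ _ hr) hP.ne_zero

end Degree

/-! ### Application to the truncations of s. -/

section Main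

theorem single_mem_puiseux {F : Type*} [Field F] (k : ℤ) (a : F) :
    (single (k : ℚ) a : Hahn F) ∈ puiseux F :=
  laurent_le_puiseux (single_mem_laurent k a)

theorem C_mem_puiseux {F : Type*} [Field F] (a : F) : (HahnSeries.C a : Hahn F) ∈ puiseux F := by
  have := single_mem_puiseux 0 a
  rwa [Int.cast_zero] at this

instance {F : Type*} [Field F] : Algebra F (puiseux F) :=
  ((HahnSeries.C : F →+* Hahn F).codRestrict (puiseux F) C_mem_puiseux).toAlgebra

instance {F : Type*} [Field F] : Algebra F (Kbar F) :=
  ((algebraMap (puiseux F) (Kbar F)).comp (algebraMap F (puiseux F))).toAlgebra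

instance {F : Type*} [Field F] : IsScalarTower F (puiseux F) (Kbar F) :=
  IsScalarTower.of_algebraMap_eq' rfl

/-- The Artin–Schreier tower `t^(-1), s_0, s_1, …`. -/
def tower (p : ℕ) [Fact p.Prime] (F : Type*) [Field F] : ℕ → Hahn F
  | 0 => single (-1 : ℚ) (1 : F)
  | m + 1 => layer p F m

variable (p : ℕ) [hp : Fact p.Prime] (F : Type*) [Field F] [CharP F p]

theorem tower_pow (m : ℕ) : tower p F (m + 1) ^ p - tower p F (m + 1) = tower p F m := by
  cases m with
  | zero => exact sub_eq_of_eq_add' (layer_zero_pow p F)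
  | succ m => exact sub_eq_of_eq_add' (layer_succ_pow p F m)

theorem natDegree_minpoly_le_of_mem_adjoin_tower (n : ℕ) {y : Hahn F}
    (hy : y ∈ IntermediateField.adjoin (puiseux F) (tower p F '' Set.Iic n)) :
    IsIntegral (puiseux F) y ∧ (minpoly (puiseux F) y).natDegree ≤ p ^ n :=
  natDegree_minpoly_le p (tower p F) ⟨_, single_mem_puiseux (-1) (1 : F)⟩
    (by simp [tower, Algebra.algebraMap_eq_smul_one, Subfield.smul_def]) (tower_pow p F) n y hy

omit [CharP F p] in
theorem trunc_mem_adjoin_tower (n i : ℕ) :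
    trunc p F n i ∈ IntermediateField.adjoin (puiseux F) (tower p F '' Set.Iic n) := by
  rw [← sub_add_cancel (trunc p F n i) (partialSum p F n)]
  refine add_mem (IntermediateField.algebraMap_mem _ (⟨_, trunc_sub_mem_puiseux p F n i⟩ : puiseux F))
    (sum_mem fun m hm => mul_mem ?_ ?_)
  · exact IntermediateField.algebraMap_mem _
      (⟨_, by exact_mod_cast single_mem_puiseux m (1 : F)⟩ : puiseux F)
  · exact IntermediateField.subset_adjoin _ _ ⟨m + 1, by
      have := Finset.mem_range.mp hm
      exact Set.mem_Iic.mpr (by omega), rfl⟩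

theorem layer_mem_Kbar (m : ℕ) : layer p F m ∈ Kbar F :=
  mem_algebraicClosure_iff.mpr (natDegree_minpoly_le_of_mem_adjoin_tower p F (m + 1)
    (IntermediateField.subset_adjoin _ _ ⟨m + 1, Set.mem_Iic.mpr le_rfl, rfl⟩)).1.isAlgebraic

theorem trunc_mem_Kbar (n i : ℕ) : trunc p F n i ∈ Kbar F :=
  mem_algebraicClosure_iff.mpr (natDegree_minpoly_le_of_mem_adjoin_tower p F n
    (trunc_mem_adjoin_tower p F n i)).1.isAlgebraic

theorem degK_eq {F : Type*} [Field F] (a : Kbar F) :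
    degK a = (minpoly (puiseux F) (a : Hahn F)).natDegree :=
  congrArg _ (minpoly.algebraMap_eq (algebraMap (Kbar F) (Hahn F)).injective a).symm

theorem degK_trunc_le (n i : ℕ) (h : trunc p F n i ∈ Kbar F) :
    degK ⟨trunc p F n i, h⟩ ≤ p ^ n := by
  rw [degK_eq]
  exact (natDegree_minpoly_le_of_mem_adjoin_tower p F n (trunc_mem_adjoin_tower p F n i)).2

/-- Both b - s_{k+1,i} and the part of layer k + 1 in s_{k+1,i} have valuation at least δ(k+1, 0) =
k + 1 - 1/p, which exceeds k. -/
theorem hahnAbs_sub_partialSum_lt {F : Type*} [Field F] (k i : ℕ) {b : Hahn F}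
    (hb : (delta p (k + 1) i : WithTop ℚ) ≤ v F (b - trunc p F (k + 1) i)) :
    hahnAbs F (b - partialSum p F (k + 1)) < 2 ^ (-((k : ℚ) : ℝ)) := by
  have h1 : hahnAbs F (b - trunc p F (k + 1) i) ≤ 2 ^ (-(delta p (k + 1) 0 : ℝ)) := by
    refine (hahnAbs_le_of_le_v hb).trans ?_
    have := (delta_strictMono p (k + 1)).monotone (Nat.zero_le i)
    exact Real.rpow_le_rpow_of_exponent_le one_le_two (neg_le_neg (by exact_mod_cast this))
  have h2 : hahnAbs F (trunc p F (k + 1) i - partialSum p F (k + 1)) ≤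
      2 ^ (-(delta p (k + 1) 0 : ℝ)) := by
    refine hahnAbs_le_of_forall_le fun q hq => ?_
    obtain ⟨j, -, rfl⟩ := exists_of_coeff_trunc_sub_ne_zero p F hq
    exact (delta_strictMono p (k + 1)).monotone (Nat.zero_le j)
  have h3 := hahnAbs_add_le_max (b - trunc p F (k + 1) i)
    (trunc p F (k + 1) i - partialSum p F (k + 1))
  rw [sub_add_sub_cancel] at h3
  refine (h3.trans (max_le h1 h2)).trans_lt ?_
  have h4 := (delta_bounds p (k + 1) 0).1
  push_cast at h4
  rw [add_sub_cancel_right] at h4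
  exact Real.rpow_lt_rpow_of_exponent_lt one_lt_two (neg_lt_neg (by exact_mod_cast h4))

instance {F : Type*} [Field F] : Algebra.IsAlgebraic (puiseux F) (Kbar F) :=
  algebraicClosure.isAlgebraic _ _

theorem pow_le_degK_of_mem_ball [IsAlgClosed F] (n i : ℕ) (h : trunc p F n i ∈ Kbar F)
    {b : Kbar F} (hb : b ∈ ball (delta p n i) ⟨trunc p F n i, h⟩) : p ^ n ≤ degK b := by
  cases n with
  | zero =>
    rw [pow_zero]
    exact minpoly.natDegree_pos (Algebra.IsIntegral.isIntegral b)
  | succ k =>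
    have : PerfectField (puiseux F) := perfectField_puiseux p F
    let T : ℕ → puiseux F := fun m => ⟨_, single_mem_puiseux m (1 : F)⟩
    have hT (m : ℕ) : ((algebraMap (puiseux F) (Kbar F) (T m) : Kbar F) : Hahn F) =
        single (m : ℚ) (1 : F) := by
      change single ((m : ℤ) : ℚ) (1 : F) = _
      rw [Int.cast_natCast]
    have hC (a : F) : ((algebraMap F (Kbar F) a : Kbar F) : Hahn F) = HahnSeries.C a := rfl
    have hsum (g : ℕ → Kbar F) (s : Finset ℕ) :
        ((∑ m ∈ s, g m : Kbar F) : Hahn F) = ∑ m ∈ s, (g m : Hahn F) :=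
      map_sum (Kbar F).val g s
    refine pow_le_natDegree_minpoly p (F := F) (C := laurent F) (K := puiseux F) (L := Kbar F)
      ((hahnAbs F).comp (f := algebraMap (Kbar F) (Hahn F)) Subtype.val_injective)
      (fun y => rfl) (fun m => ⟨layer p F m, layer_mem_Kbar p F m⟩)
      ⟨_, single_mem_puiseux (-1) (1 : F)⟩ (Subtype.ext ?_)
      (fun m => Subtype.ext (tower_pow p F (m + 1))) k (fun c hc => ?_) T
      (2 ^ (-((k : ℚ) : ℝ))) (fun e he => ?_) b ?_
    · refine (tower_pow p F 0).trans ?_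
      change single (-1 : ℚ) (1 : F) = single ((-1 : ℤ) : ℚ) (1 : F)
      norm_num
    · obtain ⟨y, hy⟩ := hc
      refine eq_zero_of_sum_layer_mem_puiseux p F (k + 1) c ?_
      have h1 := congrArg (Subtype.val : Kbar F → Hahn F) hy
      rw [hsum] at h1
      have h2 : ∑ m ∈ Finset.range (k + 1), HahnSeries.C (c m) * layer p F m = (y : Hahn F) := by
        refine Eq.trans (Finset.sum_congr rfl fun m _ => ?_) h1.symm
        rw [← hC]
        rfl
      rw [h2]
      exact y.2
    -- The coefficient of t^k in ∑ t^m e_m is e_k ≠ 0, whence the radius 2^(-k).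
    · refine le_hahnAbs_of_coeff_ne_zero (x := ((∑ m ∈ Finset.range (k + 1),
        algebraMap (puiseux F) (Kbar F) (T m) * algebraMap F (Kbar F) (e m) : Kbar F) : Hahn F)) ?_
      rw [hsum, coeff_sum, Finset.sum_eq_single k]
      · change ((algebraMap (puiseux F) (Kbar F) (T k) : Hahn F) *
          (algebraMap F (Kbar F) (e k) : Hahn F)).coeff k ≠ 0
        rw [hT, hC, HahnSeries.C_apply, single_mul_single, add_zero, one_mul, coeff_single_same]
        exact he
      · intro m _ hm
        change ((algebraMap (puiseux F) (Kbar F) (T m) : Hahn F) *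
          (algebraMap F (Kbar F) (e m) : Hahn F)).coeff k = 0
        rw [hT, hC, HahnSeries.C_apply, single_mul_single, add_zero, one_mul, coeff_single_of_ne]
        exact_mod_cast hm.symm
      · intro hk
        exact absurd (Finset.self_mem_range_succ k) hk
    · refine lt_of_eq_of_lt ?_ (hahnAbs_sub_partialSum_lt p k i hb)
      refine congrArg (hahnAbs F) (congrArg ((b : Hahn F) - ·) ?_)
      refine (hsum _ _).trans (Finset.sum_congr rfl fun m _ => ?_)
      rw [← hT]
      rfl

end Main

end MinPair

end

theorem mainTheorem5 (p : ℕ) [Fact p.Prime] (F : Type*) [Field F] [Algebra (ZMod p) F]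
    [IsAlgClosure (ZMod p) F] (n i : ℕ) (hni : (n, i) ∈ MinPair.S p) :
    ∃ h : MinPair.trunc p F n i ∈ MinPair.Kbar F,
      MinPair.IsMinimalPair ⟨MinPair.trunc p F n i, h⟩ (MinPair.delta p n i) ∧
      MinPair.ballDegK (MinPair.ball (MinPair.delta p n i) ⟨MinPair.trunc p F n i, h⟩) = p ^ n ∧
      MinPair.degK ⟨MinPair.trunc p F n i, h⟩ = p ^ n := by
  have : CharP F p := charP_of_injective_algebraMap (algebraMap (ZMod p) F).injective p
  have : IsAlgClosed F := IsAlgClosure.isAlgClosed (ZMod p)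
  have h := MinPair.trunc_mem_Kbar p F n i
  have hmem : (⟨MinPair.trunc p F n i, h⟩ : MinPair.Kbar F) ∈
      MinPair.ball (MinPair.delta p n i) ⟨MinPair.trunc p F n i, h⟩ := by
    simp [MinPair.ball]
  have hdeg : MinPair.degK ⟨MinPair.trunc p F n i, h⟩ = p ^ n :=
    le_antisymm (MinPair.degK_trunc_le p F n i h) (MinPair.pow_le_degK_of_mem_ball p F n i h hmem)
  have hball : MinPair.ballDegK
      (MinPair.ball (MinPair.delta p n i) ⟨MinPair.trunc p F n i, h⟩) = p ^ n := by
    -- The centre attains the minimum, and it rules out the default value 0 of `sInf` on the empty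
    -- set.
    refine le_antisymm (Nat.sInf_le ⟨_, hmem, hdeg⟩) (le_csInf ⟨_, _, hmem, rfl⟩ ?_)
    rintro _ ⟨b, hb, rfl⟩
    exact MinPair.pow_le_degK_of_mem_ball p F n i h hb
  exact ⟨h, hball.trans hdeg.symm, hball, hdeg⟩
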